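/- Let $N\ge 3$ be an integer, let $p_0,p_1,p_2,p_3\in[0,1]$, and put $q_m:=1-p_m$. Let $\Sigma:=\{0,1\}^N$, with coordinates of $x=(x_1,\dots,x_N)\in\Sigma$ indexed cyclically ($x_0:=x_N$, $x_{N+1}:=x_1$). For $x\in\Sigma$ and $1\le i\le N$ let $m_i(x):=2x_{i-1}+x_{i+1}\in\{0,1,2,3\}$, and let $x^i$ be $x$ with its $i$th coordinate replaced by $1-x_i$. Let $P$ be the transition matrix on $\Sigma$ with $$P(x,x^i)=\begin{cases}N^{-1}p_{m_i(x)}&\text{if }x_i=0,\\ N^{-1}q_{m_i(x)}&\text{if }x_i=1,\end{cases}\qquad P(x,x)=N^{-1}\Big(\sum_{i:x_i=0}q_{m_i(x)}+\sum_{i:x_i=1}p_{m_i(x)}\Big),$$ and $P(x,y)=0$ otherwise. Let $P^*$ be the transition matrix on $\Sigma^*:=\Sigma\times\{1,\dots,N\}$ with, for all $(x,i)\in\Sigma^*$ and $j=1,\dots,N$, $$P^*((x,i),(x^i,j))=\begin{cases}N^{-1}p_{m_i(x)}&\text{if }x_i=0,\\ N^{-1}q_{m_i(x)}&\text{if }x_i=1,\end{cases}\qquad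 P^*((x,i),(x,j))=\begin{cases}N^{-1}q_{m_i(x)}&\text{if }x_i=0,\\ N^{-1}p_{m_i(x)}&\text{if }x_i=1,\end{cases}$$ and all other entries $0$. Let the payoff $w((x,i),(y,j))$ be $1$ (a win) if $y=x^i$ and $x_i=0$, or $y=x$ and $x_i=1$ (entries $N^{-1}p_m$), and $-1$ (a loss) if $y=x^i$ and $x_i=1$, or $y=x$ and $x_i=0$ (entries $N^{-1}q_m$). Assume that the Markov chain with transition matrix $P$ is ergodic with unique stationary distribution $\pi$; that is, $\pi$ is the only stationary distribution of $P$, and for every initial distribution the distribution at time $n$ converges to $\pi$ as $n\to\infty$. Let $\pi_i$ and $\pi_{i,j}$ denote the one- and two-dimensional marginals of $\pi$. Then there is a real number $\mu^N$ such that, for every Markov chain $\{(X(n),I(n))\}_{n\ge0}$ in $\Sigma^*$ with transition matrix $P^*$ and arbitrary initial distribution, the cumulative profit $S_n:=\sum_{k=1}^n w\big((X(k-1),I(k-1)),(X(k),I(k))\big)$ satisfies $$n^{-1}S_n\to\mu^N\quad\text{almost surely.}$$ Moreover, $$\mu^N=\frac1N\sum_{x\in\Sigma}\pi(x)\sum_{i=1}^N\big[p_{m_i(x)}-q_{m_i(x)}\big];$$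 the marginals $\pi_{1,3}=\pi_{2,4}=\cdots=\pi_{N-1,1}=\pi_{N,2}$ all coincide and $$\mu^N=\sum_{u=0}^1\sum_{v=0}^1\pi_{1,3}(u,v)(p_{2u+v}-q_{2u+v})=2\big[\pi_{1,3}(0,0)p_0+\pi_{1,3}(0,1)p_1+\pi_{1,3}(1,0)p_2+\pi_{1,3}(1,1)p_3\big]-1;$$ and the marginals $\pi_1=\pi_2=\cdots=\pi_N$ all coincide and $$\mu^N=\pi_1(1)-\pi_1(0)=2\pi_1(1)-1.$$ -/

import Mathlib

open MeasureTheory Filter Topology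

namespace Parrondo

noncomputable section

/-! ### Finite Markov chains in discrete time -/

section MarkovChain

variable {S : Type*} [Fintype S] [DecidableEq S]

/-- `π` is a stationary distribution of the one-step transition matrix `P`. -/
def IsStationary (P : Matrix S S ℝ) (π : S → ℝ) : Prop :=
  π ∈ stdSimplex ℝ S ∧ Matrix.vecMul π P = π

/-- The chain with one-step transition matrix `P` is ergodic with unique stationary
distribution `π`: there is exactly one stationary distribution, namely `π`, and the distribution
at time `n` converges to it as `n → ∞`, whatever the initial distribution `ν`. -/
structure IsErgodicWith (P : Matrix S S ℝ) (π : S → ℝ) : Prop where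
  stationary : IsStationary P π
  unique : ∀ π' : S → ℝ, IsStationary P π' → π' = π
  tendsto : ∀ ν ∈ stdSimplex ℝ S, Tendsto (fun n : ℕ => Matrix.vecMul ν (P ^ n)) atTop (𝓝 π)

end MarkovChain

/-- `Z 0, Z 1, …` is a (time-homogeneous) Markov chain on the probability space `(Ω, ℙ)` with one-step
transition matrix `P`. The law of `Z 0` is arbitrary. The state space is meant to be finite or
countable, so that `measurable` says that each `Z n` is a random variable; `markov` is
`ℙ(Z (n+1) = s (n+1) | Z 0 = s 0, …, Z n = s n) = P (s n) (s (n+1))`, multiplied by the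
probability of the condition. -/
structure IsMarkovChain {S Ω : Type*} [MeasurableSpace Ω] (P : Matrix S S ℝ) (ℙ : Measure Ω)
    (Z : ℕ → Ω → S) : Prop where
  measurable : ∀ (n : ℕ) (s : S), MeasurableSet {ω | Z n ω = s}
  markov : ∀ (n : ℕ) (s : ℕ → S),
    ℙ.real {ω | ∀ k ≤ n + 1, Z k ω = s k} =
      ℙ.real {ω | ∀ k ≤ n, Z k ω = s k} * P (s n) (s (n + 1))

/-! ### The `N`-player game

Players are labelled by `ZMod N`, that is `1, …, N` modulo `N`, so that the cyclic conventions
`x₀ = x_N` and `x_{N+1} = x₁` hold automatically. -/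

/-- Status of every player: `0` for a loser, `1` for a winner. -/
abbrev Config (N : ℕ) : Type := ZMod N → Fin 2

/-- The number `2u + v ∈ {0, 1, 2, 3}`. -/
def code (u v : Fin 2) : Fin 4 := ⟨2 * u.val + v.val, by omega⟩

variable {N : ℕ}

/-- `m_i(x) = 2 x_{i-1} + x_{i+1}`. -/
def nbr (x : Config N) (i : ZMod N) : Fin 4 := code (x (i - 1)) (x (i + 1))

/-- `x^i`, the configuration `x` with the `i`-th component flipped. -/
def flipAt (x : Config N) (i : ZMod N) : Config N := Function.update x i (1 - x i)

/-- Probability that player `i`, when playing in configuration `x`, changes status. -/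
def flipProb (p : Fin 4 → ℝ) (x : Config N) (i : ZMod N) : ℝ :=
  if x i = 0 then p (nbr x i) else 1 - p (nbr x i)

/-- Probability that player `i`, when playing in configuration `x`, keeps status. -/
def stayProb (p : Fin 4 → ℝ) (x : Config N) (i : ZMod N) : ℝ :=
  if x i = 0 then 1 - p (nbr x i) else p (nbr x i)

/-- The one-step transition matrix `P` on configurations. (The configurations `x^i` are pairwise
distinct, so at most one term of the second sum is nonzero.) -/
def transition [NeZero N] (p : Fin 4 → ℝ) : Matrix (Config N) (Config N) ℝ := fun x y =>
  if y = x then (N : ℝ)⁻¹ * ∑ i : ZMod N, stayProb p x i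
  else ∑ i : ZMod N, if y = flipAt x i then (N : ℝ)⁻¹ * flipProb p x i else 0

/-- The augmented state `(x, i)`: configuration and next player to play. -/
abbrev AugState (N : ℕ) : Type := Config N × ZMod N

/-- The one-step transition matrix `P*` on augmented states. -/
def augTransition [NeZero N] (p : Fin 4 → ℝ) : Matrix (AugState N) (AugState N) ℝ := fun s t =>
  if t.1 = flipAt s.1 s.2 then (N : ℝ)⁻¹ * flipProb p s.1 s.2
  else if t.1 = s.1 then (N : ℝ)⁻¹ * stayProb p s.1 s.2
  else 0

/-- The payoff: `1` if the entry of `P*` is of the form `N⁻¹ p_m` (a win) and `-1` if it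
is of the form `N⁻¹ q_m` (a loss); `0` for the transitions that `P*` excludes. -/
def payoff [NeZero N] (s t : AugState N) : ℝ :=
  if t.1 = flipAt s.1 s.2 then (if s.1 s.2 = 0 then 1 else -1)
  else if t.1 = s.1 then (if s.1 s.2 = 0 then -1 else 1)
  else 0

/-- The ensemble's cumulative profit `S_n = ξ₁ + ⋯ + ξ_n`, with `ξ_{k+1} = w(Z_k, Z_{k+1})`. -/
def profit [NeZero N] {Ω : Type*} (Z : ℕ → Ω → AugState N) (n : ℕ) (ω : Ω) : ℝ :=
  ∑ k ∈ Finset.range n, payoff (Z k ω) (Z (k + 1) ω)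

/-- The one-dimensional marginal `π_i(u)`. -/
def marginal₁ [NeZero N] (π : Config N → ℝ) (i : ZMod N) (u : Fin 2) : ℝ :=
  ∑ x : Config N with x i = u, π x

/-- The two-dimensional marginal `π_{i,j}(u,v)`. -/
def marginal₂ [NeZero N] (π : Config N → ℝ) (i j : ZMod N) (u v : Fin 2) : ℝ :=
  ∑ x : Config N with x i = u ∧ x j = v, π x

end

end Parrondo

/-!
The matrix `P*` chooses the next player uniformly at random, so that its only stationary
distribution is `N⁻¹ π(x)`, and by the ergodic theorem `S_n / n` tends to the mean payoff under it.

The ergodic theorem for a finite chain with a unique stationary distribution rests on the Poisson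
equation `φ - P φ = f`. If `v` is a left fixed vector of `P` then so is `|v|`, hence uniqueness
makes `π` span the left kernel of `1 - P`, and the equation is solvable as soon as `f` has mean zero
under `π`. A solution turns the centred sums into a bounded boundary term plus a sum of bounded,
pairwise orthogonal increments. The second moment of the latter grows linearly, so its averages tend
to zero almost surely along the squares, and therefore along all integers.

Since `P` commutes with rotations of the players, uniqueness makes `π` rotation invariant, and the
mean payoff is the mean gain `p_m - q_m` of any single player. Stationarity applied to the event
`x_i = 1` gives `π_i(1) = ∑ π(x) p_{m_i(x)}`: in equilibrium a player wins a turn with the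
probability of being a winner.
-/

namespace Parrondo

/-! ### A strong law for bounded orthogonal increments -/

section StrongLaw

variable {Ω : Type*} [MeasurableSpace Ω] {μ : Measure Ω}

theorem ae_tendsto_zero_of_summable_integral_norm {ι E : Type*} [Countable ι]
    [NormedAddCommGroup E] {f : ι → Ω → E} (hf : ∀ i, Integrable (f i) μ)
    (hsum : Summable fun i => ∫ ω, ‖f i ω‖ ∂μ) :
    ∀ᵐ ω ∂μ, Tendsto (fun i => f i ω) cofinite (𝓝 0) := by
  have hmeas : ∀ i, AEMeasurable (fun ω => ‖f i ω‖ₑ) μ :=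
    fun i => (hf i).aestronglyMeasurable.enorm
  have hfin : ∫⁻ ω, ∑' i, ‖f i ω‖ₑ ∂μ ≠ ⊤ := by
    rw [lintegral_tsum hmeas]
    simpa only [ofReal_integral_norm_eq_lintegral_enorm (hf _)] using hsum.tsum_ofReal_ne_top
  filter_upwards [ae_lt_top' (AEMeasurable.tsum hmeas) hfin] with ω hω
  exact tendsto_zero_iff_enorm_tendsto_zero.2
    (ENNReal.tendsto_cofinite_zero_of_tsum_ne_top hω.ne)

theorem integral_sq_sum_of_orthogonal {ι : Type*} {D : ι → Ω → ℝ} (hD : ∀ i, MemLp (D i) 2 μ)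
    (horth : Pairwise fun i j => ∫ ω, D i ω * D j ω ∂μ = 0) (s : Finset ι) :
    ∫ ω, (∑ i ∈ s, D i ω) ^ 2 ∂μ = ∑ i ∈ s, ∫ ω, D i ω ^ 2 ∂μ := by
  have hint : ∀ i j, Integrable (fun ω => D i ω * D j ω) μ :=
    fun i j => (hD i).integrable_mul (hD j)
  simp only [sq, Finset.sum_mul_sum]
  rw [integral_finsetSum s fun i _ => integrable_finsetSum s fun j _ => hint i j]
  refine Finset.sum_congr rfl fun i hi => ?_
  rw [integral_finsetSum s fun j _ => hint i j]
  exact Finset.sum_eq_single_of_mem i hi fun j _ hji => horth hji.symm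

theorem tendsto_div_of_tendsto_div_sq {u : ℕ → ℝ} {B l : ℝ} (hu : ∀ n, u n ≤ u (n + 1) + B)
    (hsq : Tendsto (fun n : ℕ => u (n ^ 2) / (n ^ 2 : ℕ)) atTop (𝓝 l)) :
    Tendsto (fun n : ℕ => u n / n) atTop (𝓝 l) := by
  -- Adding `B * n` makes `u` monotone, and consecutive squares have ratio tending to `1`.
  have hshift : ∀ n : ℕ, n ≠ 0 → (u n + B * n) / n = u n / n + B := fun n hn => by field_simp
  have hmono : Monotone fun n : ℕ => u n + B * n :=
    monotone_nat_of_le_succ fun n => by push_cast; linarith [hu n]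
  have hsq_shift : Tendsto (fun n : ℕ => (u (n ^ 2) + B * (n ^ 2 : ℕ)) / (n ^ 2 : ℕ)) atTop
      (𝓝 (l + B)) := by
    refine (hsq.add_const B).congr' ?_
    filter_upwards [eventually_ne_atTop 0] with n hn
    rw [hshift _ (pow_ne_zero 2 hn)]
  have hratio : Tendsto (fun n : ℕ => (1 + 1 / (n : ℝ)) ^ 2) atTop (𝓝 1) := by
    simpa using (tendsto_one_div_atTop_nhds_zero_nat (𝕜 := ℝ).const_add 1).pow 2
  have hlim : Tendsto (fun n : ℕ => (u n + B * n) / n) atTop (𝓝 (l + B)) := by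
    refine tendsto_div_of_monotone_of_exists_subseq_tendsto_div _ _ hmono fun a ha =>
      ⟨fun n => n ^ 2, ?_, tendsto_pow_atTop two_ne_zero, hsq_shift⟩
    filter_upwards [hratio.eventually_le_const ha, eventually_ne_atTop 0] with n hn hn₀
    calc (((n + 1) ^ 2 : ℕ) : ℝ) = (1 + 1 / (n : ℝ)) ^ 2 * (n ^ 2 : ℕ) := by
          push_cast; field_simp
      _ ≤ a * (n ^ 2 : ℕ) := by gcongr
  rw [← add_sub_cancel_right l B]
  refine (hlim.sub_const B).congr' ?_
  filter_upwards [eventually_ne_atTop 0] with n hn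
  rw [hshift n hn, add_sub_cancel_right]

variable [IsFiniteMeasure μ] {D : ℕ → Ω → ℝ} {B : ℝ}

theorem integral_sq_sum_le_of_orthogonal (hD : ∀ n, AEStronglyMeasurable (D n) μ)
    (hB : ∀ n, ∀ᵐ ω ∂μ, |D n ω| ≤ B)
    (horth : Pairwise fun i j => ∫ ω, D i ω * D j ω ∂μ = 0) (n : ℕ) :
    ∫ ω, (∑ k ∈ Finset.range n, D k ω) ^ 2 ∂μ ≤ n * (B ^ 2 * μ.real Set.univ) := by
  have hLp : ∀ k, MemLp (D k) 2 μ := fun k => MemLp.of_bound (hD k) B (hB k)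
  have hsq : ∀ k, ∫ ω, D k ω ^ 2 ∂μ ≤ B ^ 2 * μ.real Set.univ := fun k => by
    calc ∫ ω, D k ω ^ 2 ∂μ ≤ ∫ _, B ^ 2 ∂μ :=
          integral_mono_ae (hLp k).integrable_sq (integrable_const _) <|
            (hB k).mono fun _ hω => sq_le_sq' (abs_le.1 hω).1 (abs_le.1 hω).2
      _ = B ^ 2 * μ.real Set.univ := by rw [integral_const, smul_eq_mul, mul_comm]
  rw [integral_sq_sum_of_orthogonal hLp horth]
  calc ∑ k ∈ Finset.range n, ∫ ω, D k ω ^ 2 ∂μ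
      ≤ ∑ _k ∈ Finset.range n, B ^ 2 * μ.real Set.univ := Finset.sum_le_sum fun k _ => hsq k
    _ = n * (B ^ 2 * μ.real Set.univ) := by simp

theorem ae_tendsto_sum_sq_div_of_orthogonal (hD : ∀ n, AEStronglyMeasurable (D n) μ)
    (hB : ∀ n, ∀ᵐ ω ∂μ, |D n ω| ≤ B)
    (horth : Pairwise fun i j => ∫ ω, D i ω * D j ω ∂μ = 0) :
    ∀ᵐ ω ∂μ, Tendsto (fun n : ℕ => (∑ k ∈ Finset.range (n ^ 2), D k ω) / (n ^ 2 : ℕ)) atTop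
      (𝓝 0) := by
  let a : ℕ → Ω → ℝ := fun n ω => (∑ k ∈ Finset.range (n ^ 2), D k ω) / (n ^ 2 : ℕ)
  have hLp : ∀ n, MemLp (fun ω => ∑ k ∈ Finset.range n, D k ω) 2 μ := fun n =>
    memLp_finsetSum _ fun k _ => MemLp.of_bound (hD k) B (hB k)
  have hint : ∀ n, Integrable (fun ω => a n ω ^ 2) μ := fun n => by
    simpa only [a, div_pow] using (hLp (n ^ 2)).integrable_sq.div_const _
  have hle : ∀ n, ∫ ω, ‖a n ω ^ 2‖ ∂μ ≤ 1 / (n : ℝ) ^ 2 * (B ^ 2 * μ.real Set.univ) := fun n => by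
    have hmoment := integral_sq_sum_le_of_orthogonal hD hB horth (n ^ 2)
    simp only [norm_pow, Real.norm_eq_abs, sq_abs]
    simp only [a, div_pow, integral_div]
    rcases eq_or_ne n 0 with rfl | hn
    · simp
    · rw [div_le_iff₀ (by positivity)]
      refine hmoment.trans_eq ?_
      push_cast
      field_simp
  have hsum : Summable fun n => ∫ ω, ‖a n ω ^ 2‖ ∂μ :=
    .of_nonneg_of_le (fun _ => integral_nonneg fun _ => norm_nonneg _) hle
      ((Real.summable_one_div_nat_pow.2 one_lt_two).mul_right _)
  filter_upwards [ae_tendsto_zero_of_summable_integral_norm hint hsum] with ω hω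
  rw [Nat.cofinite_eq_atTop] at hω
  refine (tendsto_zero_iff_abs_tendsto_zero _).2 ?_
  simpa only [Function.comp_def, Real.sqrt_sq_eq_abs, Real.sqrt_zero] using hω.sqrt

theorem ae_tendsto_sum_div_of_orthogonal (hD : ∀ n, AEStronglyMeasurable (D n) μ)
    (hB : ∀ n, ∀ᵐ ω ∂μ, |D n ω| ≤ B)
    (horth : Pairwise fun i j => ∫ ω, D i ω * D j ω ∂μ = 0) :
    ∀ᵐ ω ∂μ, Tendsto (fun n : ℕ => (∑ k ∈ Finset.range n, D k ω) / n) atTop (𝓝 0) := by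
  filter_upwards [ae_tendsto_sum_sq_div_of_orthogonal hD hB horth, ae_all_iff.2 hB] with ω hω hbound
  refine tendsto_div_of_tendsto_div_sq (B := B) (fun n => ?_) hω
  rw [Finset.sum_range_succ]
  linarith [(abs_le.1 (hbound n)).1]

end StrongLaw

/-! ### The ergodic theorem for finite Markov chains -/

section MarkovChain

variable {S Ω : Type*}

/-- The trajectory of the process `Z` up to and including time `n`. -/
def history (Z : ℕ → Ω → S) (n : ℕ) (ω : Ω) (k : Fin (n + 1)) : S := Z k ω

variable [MeasurableSpace Ω] {Q : Matrix S S ℝ} {ℙ : Measure Ω} {Z : ℕ → Ω → S}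

theorem integral_comp_eq_sum [IsFiniteMeasure ℙ] {T : Type*} [Fintype T] [MeasurableSpace T]
    [MeasurableSingletonClass T] {Y : Ω → T} (hY : Measurable Y) (f : T → ℝ) :
    ∫ ω, f (Y ω) ∂ℙ = ∑ t, ℙ.real (Y ⁻¹' {t}) * f t := by
  rw [← integral_map hY.aemeasurable Measurable.of_discrete.aestronglyMeasurable,
    integral_fintype .of_finite]
  simp only [map_measureReal_apply hY (measurableSet_singleton _), smul_eq_mul]

namespace IsMarkovChain

theorem measureReal_history_inter (hZ : IsMarkovChain Q ℙ Z) (n : ℕ) (s : Fin (n + 1) → S)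
    (t : S) :
    ℙ.real (history Z n ⁻¹' {s} ∩ Z (n + 1) ⁻¹' {t}) =
      ℙ.real (history Z n ⁻¹' {s}) * Q (s (Fin.last n)) t := by
  let path : ℕ → S := fun k => if hk : k < n + 1 then s ⟨k, hk⟩ else t
  have hpath : ∀ k : Fin (n + 1), path k = s k := fun k => dif_pos k.is_lt
  have hnext : path (n + 1) = t := dif_neg (lt_irrefl _)
  have hpast : {ω | ∀ k ≤ n, Z k ω = path k} = history Z n ⁻¹' {s} := by
    ext ω
    simp [history, funext_iff, ← hpath, Fin.forall_iff]
  have hfull : {ω | ∀ k ≤ n + 1, Z k ω = path k} =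
      history Z n ⁻¹' {s} ∩ Z (n + 1) ⁻¹' {t} := by
    rw [← hpast]
    ext ω
    simp [Nat.le_succ_iff, or_imp, forall_and, hnext]
  have hmarkov := hZ.markov n path
  rwa [hpast, hfull, hnext, show path n = s (Fin.last n) from hpath (Fin.last n)] at hmarkov

section Discrete

variable [MeasurableSpace S]

theorem measurable_coordinate [Countable S] (hZ : IsMarkovChain Q ℙ Z) (n : ℕ) :
    Measurable (Z n) :=
  measurable_to_countable' (hZ.measurable n)

theorem measurable_history [Countable S] (hZ : IsMarkovChain Q ℙ Z) (n : ℕ) :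
    Measurable (history Z n) :=
  measurable_pi_lambda _ fun k => hZ.measurable_coordinate k

variable [MeasurableSingletonClass S] [Fintype S] [IsFiniteMeasure ℙ]

theorem integral_history_mul_eq_zero (hZ : IsMarkovChain Q ℙ Z) {F : S → S → ℝ}
    (hF : ∀ s, ∑ t, Q s t * F s t = 0) (n : ℕ) (G : (Fin (n + 1) → S) → ℝ) :
    ∫ ω, G (history Z n ω) * F (Z n ω) (Z (n + 1) ω) ∂ℙ = 0 := by
  classical
  have hpair : Measurable fun ω => (history Z n ω, Z (n + 1) ω) :=
    (hZ.measurable_history n).prodMk (hZ.measurable_coordinate (n + 1))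
  refine (integral_comp_eq_sum (ℙ := ℙ) hpair fun s => G s.1 * F (s.1 (Fin.last n)) s.2).trans ?_
  rw [Fintype.sum_prod_type]
  refine Finset.sum_eq_zero fun s _ => ?_
  calc ∑ t, ℙ.real ((fun ω => (history Z n ω, Z (n + 1) ω)) ⁻¹' {(s, t)}) *
        (G s * F (s (Fin.last n)) t)
      = ∑ t, ℙ.real (history Z n ⁻¹' {s}) * G s *
          (Q (s (Fin.last n)) t * F (s (Fin.last n)) t) := by
        refine Finset.sum_congr rfl fun t _ => ?_
        rw [← Set.singleton_prod_singleton, Set.mk_preimage_prod, hZ.measureReal_history_inter]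
        ring
    _ = 0 := by rw [← Finset.mul_sum, hF, mul_zero]

theorem integral_mul_eq_zero_of_lt (hZ : IsMarkovChain Q ℙ Z) {F : S → S → ℝ}
    (hF : ∀ s, ∑ t, Q s t * F s t = 0) {j k : ℕ} (hjk : j < k) :
    ∫ ω, F (Z j ω) (Z (j + 1) ω) * F (Z k ω) (Z (k + 1) ω) ∂ℙ = 0 :=
  hZ.integral_history_mul_eq_zero hF k fun s => F (s ⟨j, by lia⟩) (s ⟨j + 1, by lia⟩)

end Discrete

variable [Fintype S]

theorem ae_tendsto_sum_div_of_centered [IsFiniteMeasure ℙ] (hZ : IsMarkovChain Q ℙ Z)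
    {F : S → S → ℝ} (hF : ∀ s, ∑ t, Q s t * F s t = 0) :
    ∀ᵐ ω ∂ℙ, Tendsto (fun n : ℕ => (∑ k ∈ Finset.range n, F (Z k ω) (Z (k + 1) ω)) / n) atTop
      (𝓝 0) := by
  let _ : MeasurableSpace S := ⊤
  obtain ⟨B, hB⟩ := Finite.exists_le fun s : S × S => |F s.1 s.2|
  refine ae_tendsto_sum_div_of_orthogonal (fun n => ?_) (fun n => ae_of_all _ fun ω => hB (_, _))
    fun j k hjk => ?_
  · have hpair : Measurable fun ω => (Z n ω, Z (n + 1) ω) :=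
      (hZ.measurable_coordinate n).prodMk (hZ.measurable_coordinate (n + 1))
    exact ((Measurable.of_discrete (f := F.uncurry)).comp hpair).aestronglyMeasurable
  · rcases hjk.lt_or_gt with hlt | hgt
    · exact hZ.integral_mul_eq_zero_of_lt hF hlt
    · simpa only [mul_comm] using hZ.integral_mul_eq_zero_of_lt hF hgt

theorem ae_tendsto_of_poisson [IsFiniteMeasure ℙ] (hZ : IsMarkovChain Q ℙ Z)
    (hQ : ∀ s, ∑ t, Q s t = 1) {w : S → S → ℝ} {φ : S → ℝ} {c : ℝ}
    (hφ : ∀ s, φ s - ∑ t, Q s t * φ t = ∑ t, Q s t * w s t - c) :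
    ∀ᵐ ω ∂ℙ, Tendsto (fun n : ℕ => (n : ℝ)⁻¹ * ∑ k ∈ Finset.range n, w (Z k ω) (Z (k + 1) ω))
      atTop (𝓝 c) := by
  have hcentered : ∀ s, ∑ t, Q s t * (w s t - c + (φ t - φ s)) = 0 := fun s => by
    simp only [mul_add, mul_sub, Finset.sum_add_distrib, Finset.sum_sub_distrib,
      ← Finset.sum_mul, hQ]
    linarith [hφ s]
  obtain ⟨B, hB⟩ := Finite.exists_le fun s : S × S => |φ s.1 - φ s.2|
  filter_upwards [hZ.ae_tendsto_sum_div_of_centered hcentered] with ω hω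
  have hboundary : Tendsto (fun n : ℕ => (φ (Z n ω) - φ (Z 0 ω)) / n) atTop (𝓝 0) :=
    squeeze_zero_norm (fun n => by
      rw [norm_div, Real.norm_eq_abs, Real.norm_natCast]
      gcongr
      exact hB (Z n ω, Z 0 ω)) (tendsto_const_div_atTop_nhds_zero_nat B)
  have hlim := (hω.sub hboundary).add_const c
  rw [sub_zero, zero_add] at hlim
  refine hlim.congr' ?_
  filter_upwards [eventually_ne_atTop 0] with n hn
  rw [Finset.sum_add_distrib, Finset.sum_range_sub (fun k => φ (Z k ω)), Finset.sum_sub_distrib,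
    Finset.sum_const, Finset.card_range, nsmul_eq_mul]
  field_simp
  ring

end IsMarkovChain

end MarkovChain

/-! ### Unique stationary distributions -/

section Stationary

open Matrix

variable {S : Type*} [Fintype S]

theorem IsStationary.dotProduct_mulVec {P : Matrix S S ℝ} {π : S → ℝ} (hπ : IsStationary P π)
    (f : S → ℝ) : π ⬝ᵥ (P *ᵥ f) = π ⬝ᵥ f := by
  rw [Matrix.dotProduct_mulVec, hπ.2]

/-- `π` is the one and only stationary distribution of `P`. -/
structure IsUniqueStationary (P : Matrix S S ℝ) (π : S → ℝ) : Prop where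
  stationary : IsStationary P π
  unique : ∀ π' : S → ℝ, IsStationary P π' → π' = π

theorem IsErgodicWith.isUniqueStationary [DecidableEq S] {P : Matrix S S ℝ} {π : S → ℝ}
    (h : IsErgodicWith P π) : IsUniqueStationary P π :=
  ⟨h.stationary, h.unique⟩

namespace IsUniqueStationary

variable {P : Matrix S S ℝ} {π : S → ℝ}

theorem sum_eq_one (hπ : IsUniqueStationary P π) : ∑ s, π s = 1 := hπ.stationary.1.2

theorem apply_equiv (hπ : IsUniqueStationary P π) {σ : S ≃ S} (hσ : P.submatrix σ σ = P)
    (s : S) : π (σ s) = π s := by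
  refine congrFun (hπ.unique (π ∘ σ) ⟨⟨fun s => hπ.stationary.1.1 (σ s), ?_⟩, ?_⟩) s
  · exact (Equiv.sum_comp σ π).trans hπ.sum_eq_one
  · calc (π ∘ σ) ᵥ* P = (π ∘ σ) ᵥ* P.submatrix σ σ := by rw [hσ]
      _ = (π ᵥ* P) ∘ σ := by
        rw [submatrix_vecMul_equiv, Function.comp_assoc, σ.self_comp_symm, Function.comp_id]
      _ = π ∘ σ := by rw [hπ.stationary.2]

theorem eq_sum_smul_of_nonneg (hπ : IsUniqueStationary P π) {v : S → ℝ} (hv : v ᵥ* P = v)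
    (hv₀ : 0 ≤ v) : v = (∑ s, v s) • π := by
  rcases eq_or_ne (∑ s, v s) 0 with hsum | hsum
  · rw [hsum, zero_smul]
    exact (Fintype.sum_eq_zero_iff_of_nonneg hv₀).1 hsum
  · have hnormalized : IsStationary P ((∑ s, v s)⁻¹ • v) := by
      refine ⟨⟨fun s => ?_, ?_⟩, by rw [smul_vecMul, hv]⟩
      · exact mul_nonneg (inv_nonneg.2 (Finset.sum_nonneg fun s _ => hv₀ s)) (hv₀ s)
      · simp only [Pi.smul_apply, smul_eq_mul, ← Finset.mul_sum, inv_mul_cancel₀ hsum]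
    rw [← hπ.unique _ hnormalized, smul_inv_smul₀ hsum]

end IsUniqueStationary

section Stochastic

variable [DecidableEq S] {P : Matrix S S ℝ} {π : S → ℝ}

theorem abs_vecMul_of_vecMul_eq (hP : P ∈ rowStochastic ℝ S) {v : S → ℝ} (hv : v ᵥ* P = v) :
    |v| ᵥ* P = |v| := by
  have hle : ∀ t, |v| t ≤ (|v| ᵥ* P) t := fun t => by
    calc |v t| = |∑ s, v s * P s t| := by rw [← congrFun hv t]; rfl
      _ ≤ ∑ s, |v s * P s t| := Finset.abs_sum_le_sum_abs _ _
      _ = ∑ s, |v s| * P s t := by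
        simp only [abs_mul, abs_of_nonneg (nonneg_of_mem_rowStochastic hP)]
  have hsum : ∑ t, |v| t = ∑ t, (|v| ᵥ* P) t := by
    simp only [vecMul, dotProduct]
    rw [Finset.sum_comm]
    simp only [← Finset.mul_sum, sum_row_of_mem_rowStochastic hP, mul_one]
  funext t
  exact ((Finset.sum_eq_sum_iff_of_le fun t _ => hle t).1 hsum t (Finset.mem_univ t)).symm

namespace IsUniqueStationary

theorem exists_eq_smul (hπ : IsUniqueStationary P π) (hP : P ∈ rowStochastic ℝ S) {v : S → ℝ}
    (hv : v ᵥ* P = v) : ∃ c : ℝ, v = c • π := by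
  have habs := abs_vecMul_of_vecMul_eq hP hv
  have hadd : (|v| + v) ᵥ* P = |v| + v := by rw [add_vecMul, habs, hv]
  have hadd_nonneg : 0 ≤ |v| + v := fun s => neg_le_iff_add_nonneg'.1 (neg_abs_le (v s))
  refine ⟨∑ s, (|v| + v) s - ∑ s, |v| s, ?_⟩
  calc v = (|v| + v) - |v| := (add_sub_cancel_left _ _).symm
    _ = (∑ s, (|v| + v) s) • π - (∑ s, |v| s) • π := by
      rw [← hπ.eq_sum_smul_of_nonneg hadd hadd_nonneg,
        ← hπ.eq_sum_smul_of_nonneg habs (abs_nonneg v)]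
    _ = _ := (sub_smul _ _ _).symm

theorem exists_poisson (hπ : IsUniqueStationary P π) (hP : P ∈ rowStochastic ℝ S) {f : S → ℝ}
    (hf : π ⬝ᵥ f = 0) : ∃ φ : S → ℝ, φ - P *ᵥ φ = f := by
  suffices hrange : f ∈ LinearMap.range (1 - P).mulVecLin by
    obtain ⟨φ, hφ⟩ := hrange
    exact ⟨φ, by rwa [mulVecLin_apply, sub_mulVec, one_mulVec] at hφ⟩
  by_contra hrange
  -- A functional vanishing on the range of `1 - P` is a left fixed vector of `P`.
  obtain ⟨ℓ, hℓf, hℓ⟩ := Submodule.exists_le_ker_of_notMem hrange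
  obtain ⟨v, rfl⟩ := (dotProductEquiv ℝ S).surjective ℓ
  have hv : v ᵥ* P = v := by
    refine dotProduct_eq _ _ fun φ => ?_
    have hφ : v ⬝ᵥ ((1 - P) *ᵥ φ) = 0 := hℓ ⟨φ, rfl⟩
    rw [sub_mulVec, one_mulVec, dotProduct_sub, Matrix.dotProduct_mulVec] at hφ
    exact (sub_eq_zero.1 hφ).symm
  obtain ⟨c, rfl⟩ := hπ.exists_eq_smul hP hv
  exact hℓf (by rw [dotProductEquiv_apply_apply, smul_dotProduct, hf, smul_zero])

end IsUniqueStationary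

theorem IsMarkovChain.ae_tendsto_average {Ω : Type*} [MeasurableSpace Ω] {ℙ : Measure Ω}
    [IsFiniteMeasure ℙ] {Z : ℕ → Ω → S} (hZ : IsMarkovChain P ℙ Z) (hP : P ∈ rowStochastic ℝ S)
    (hπ : IsUniqueStationary P π) (w : S → S → ℝ) :
    ∀ᵐ ω ∂ℙ, Tendsto (fun n : ℕ => (n : ℝ)⁻¹ * ∑ k ∈ Finset.range n, w (Z k ω) (Z (k + 1) ω))
      atTop (𝓝 (∑ s, π s * ∑ t, P s t * w s t)) := by
  obtain ⟨φ, hφ⟩ := hπ.exists_poisson hP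
    (f := fun s => ∑ t, P s t * w s t - ∑ s, π s * ∑ t, P s t * w s t) (by
      simp only [dotProduct, mul_sub, Finset.sum_sub_distrib, ← Finset.sum_mul, hπ.sum_eq_one,
        one_mul, sub_self])
  exact hZ.ae_tendsto_of_poisson (sum_row_of_mem_rowStochastic hP) (congrFun hφ)

end Stochastic

theorem IsUniqueStationary.prod_uniform {I : Type*} [Fintype I] [Nonempty I]
    {P : Matrix S S ℝ} {π : S → ℝ} (hπ : IsUniqueStationary P π) {Q : Matrix (S × I) (S × I) ℝ}
    (hconst : ∀ s y j k, Q s (y, j) = Q s (y, k)) (hsum : ∀ x y j, ∑ i, Q (x, i) (y, j) = P x y) :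
    IsUniqueStationary Q fun s => (Fintype.card I : ℝ)⁻¹ * π s.1 := by
  have hcard : (Fintype.card I : ℝ) ≠ 0 := Nat.cast_ne_zero.2 Fintype.card_ne_zero
  have hmul : ∀ (m : S → ℝ) y j, ((fun s => (Fintype.card I : ℝ)⁻¹ * m s.1) ᵥ* Q) (y, j) =
      (Fintype.card I : ℝ)⁻¹ * (m ᵥ* P) y := fun m y j => by
    simp only [vecMul, dotProduct, Fintype.sum_prod_type, mul_assoc, ← Finset.mul_sum, hsum]
  refine ⟨⟨⟨fun s => ?_, ?_⟩, ?_⟩, fun ρ hρ => ?_⟩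
  · exact mul_nonneg (by positivity) (hπ.stationary.1.1 s.1)
  · simp [Fintype.sum_prod_type, hcard, hπ.sum_eq_one]
  · funext ⟨y, j⟩
    rw [hmul, hπ.stationary.2]
  · let m : S → ℝ := fun y => ∑ i, ρ (y, i)
    have hρ_const : ∀ y j k, ρ (y, j) = ρ (y, k) := fun y j k => by
      rw [← hρ.2]
      simp only [vecMul, dotProduct, hconst _ y j k]
    have hρ_eq : ρ = fun s => (Fintype.card I : ℝ)⁻¹ * m s.1 := by
      funext ⟨y, j⟩
      simp [m, hρ_const y _ j, hcard]
    have hm : IsStationary P m := by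
      refine ⟨⟨fun y => Finset.sum_nonneg fun i _ => hρ.1.1 (y, i), ?_⟩, ?_⟩
      · exact (Fintype.sum_prod_type ρ).symm.trans hρ.1.2
      · funext y
        have hy := congrFun hρ.2 (y, Classical.arbitrary I)
        rw [hρ_eq, hmul] at hy
        exact mul_left_cancel₀ (inv_ne_zero hcard) hy
    rw [hρ_eq, hπ.unique m hm]

end Stationary

/-! ### The game -/

section Game

open Matrix

variable {N : ℕ}

theorem flipAt_ne (x : Config N) (i : ZMod N) : flipAt x i ≠ x := by
  rw [flipAt, Ne, Function.update_eq_self_iff]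
  generalize x i = u
  decide +revert

theorem flipProb_add_stayProb (p : Fin 4 → ℝ) (x : Config N) (i : ZMod N) :
    flipProb p x i + stayProb p x i = 1 := by
  unfold flipProb stayProb
  split_ifs <;> ring

theorem flipProb_nonneg {p : Fin 4 → ℝ} (hp : ∀ m, p m ∈ Set.Icc 0 1) (x : Config N)
    (i : ZMod N) : 0 ≤ flipProb p x i := by
  unfold flipProb
  split_ifs
  · exact (hp _).1
  · exact sub_nonneg.2 (hp _).2

theorem stayProb_nonneg {p : Fin 4 → ℝ} (hp : ∀ m, p m ∈ Set.Icc 0 1) (x : Config N)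
    (i : ZMod N) : 0 ≤ stayProb p x i := by
  unfold stayProb
  split_ifs
  · exact sub_nonneg.2 (hp _).2
  · exact (hp _).1

/-- The rotation of configurations by `c` places, as a permutation of the state space of the
chain. -/
def rotate (c : ZMod N) : Config N ≃ Config N :=
  (Equiv.addRight (-c)).arrowCongr (Equiv.refl (Fin 2))

theorem rotate_apply (c : ZMod N) (x : Config N) (i : ZMod N) : rotate c x i = x (i + c) := by
  simp [rotate]

theorem nbr_rotate (c : ZMod N) (x : Config N) (i : ZMod N) :
    nbr (rotate c x) i = nbr x (i + c) := by
  simp only [nbr, rotate_apply]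
  congr 2 <;> ring

theorem flipAt_rotate (c : ZMod N) (x : Config N) (i : ZMod N) :
    flipAt (rotate c x) i = rotate c (flipAt x (i + c)) := by
  funext j
  simp only [flipAt, rotate_apply, Function.update_apply, add_left_inj]

variable [NeZero N]

theorem sum_augTransition_mul (p : Fin 4 → ℝ) (s : AugState N) (f : Config N → ℝ) (j : ZMod N) :
    ∑ y, augTransition p s (y, j) * f y = (N : ℝ)⁻¹ *
      (flipProb p s.1 s.2 * f (flipAt s.1 s.2) + stayProb p s.1 s.2 * f s.1) := by
  have hne : flipAt s.1 s.2 ≠ s.1 := flipAt_ne s.1 s.2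
  have hother : ∀ y, y ≠ flipAt s.1 s.2 ∧ y ≠ s.1 → augTransition p s (y, j) * f y = 0 :=
    fun y hy => by simp only [augTransition, if_neg hy.1, if_neg hy.2, zero_mul]
  rw [Fintype.sum_eq_add _ _ hne hother]
  simp only [augTransition, if_true, if_neg hne.symm]
  ring

theorem sum_augTransition_mul_payoff (p : Fin 4 → ℝ) (s : AugState N) :
    ∑ t, augTransition p s t * payoff s t = p (nbr s.1 s.2) - (1 - p (nbr s.1 s.2)) := by
  have hgain : ∀ j : ZMod N, ∑ y, augTransition p s (y, j) * payoff s (y, j) =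
      (N : ℝ)⁻¹ * (p (nbr s.1 s.2) - (1 - p (nbr s.1 s.2))) := fun j => by
    rw [sum_augTransition_mul p s (fun y => payoff s (y, j))]
    simp only [payoff, if_true, if_neg (flipAt_ne s.1 s.2).symm, flipProb, stayProb]
    split_ifs <;> ring
  rw [Fintype.sum_prod_type_right]
  simp only [hgain, Finset.sum_const, Finset.card_univ, ZMod.card, nsmul_eq_mul]
  exact mul_inv_cancel_left₀ (NeZero.ne _) _

theorem augTransition_mem_rowStochastic {p : Fin 4 → ℝ} (hp : ∀ m, p m ∈ Set.Icc 0 1) :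
    augTransition p ∈ rowStochastic ℝ (AugState N) := by
  refine mem_rowStochastic_iff_sum.2 ⟨fun s t => ?_, fun s => ?_⟩
  · have hflip := flipProb_nonneg hp s.1 s.2
    have hstay := stayProb_nonneg hp s.1 s.2
    unfold augTransition
    split_ifs <;> positivity
  · have hrow : ∀ j, ∑ y, augTransition p s (y, j) = (N : ℝ)⁻¹ := fun j => by
      simpa [flipProb_add_stayProb] using sum_augTransition_mul p s 1 j
    rw [Fintype.sum_prod_type_right]
    simp only [hrow, Finset.sum_const, Finset.card_univ, ZMod.card, nsmul_eq_mul]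
    exact mul_inv_cancel₀ (NeZero.ne _)

theorem sum_augTransition_eq_transition (p : Fin 4 → ℝ) (x y : Config N) (j : ZMod N) :
    ∑ i, augTransition p (x, i) (y, j) = transition p x y := by
  rcases eq_or_ne y x with rfl | hyx
  · simp only [augTransition, transition, if_true, if_neg (flipAt_ne y _).symm, Finset.mul_sum]
  · simp only [augTransition, transition, if_neg hyx]

theorem transition_mulVec_apply (p : Fin 4 → ℝ) (f : Config N → ℝ) (x : Config N) :
    (transition p *ᵥ f) x =
      f x + (N : ℝ)⁻¹ * ∑ i, flipProb p x i * (f (flipAt x i) - f x) := by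
  have hN : (N : ℝ) ≠ 0 := NeZero.ne _
  have hstay : ∀ i, stayProb p x i = 1 - flipProb p x i :=
    fun i => eq_sub_of_add_eq' (flipProb_add_stayProb p x i)
  calc (transition p *ᵥ f) x
      = ∑ i, ∑ y, augTransition p (x, i) (y, 0) * f y := by
        rw [Finset.sum_comm]
        simp only [← Finset.sum_mul, sum_augTransition_eq_transition]
        rfl
    _ = ∑ i, ((N : ℝ)⁻¹ * f x + (N : ℝ)⁻¹ * (flipProb p x i * (f (flipAt x i) - f x))) := by
        refine Finset.sum_congr rfl fun i _ => ?_
        rw [sum_augTransition_mul, hstay]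
        ring
    _ = f x + (N : ℝ)⁻¹ * ∑ i, flipProb p x i * (f (flipAt x i) - f x) := by
        rw [Finset.sum_add_distrib, Finset.sum_const, Finset.card_univ, ZMod.card, nsmul_eq_mul,
          mul_inv_cancel_left₀ hN, ← Finset.mul_sum]

theorem transition_submatrix_rotate (p : Fin 4 → ℝ) (c : ZMod N) :
    (transition p).submatrix (rotate c) (rotate c) = transition p := by
  ext x y
  have hstay : ∀ i, stayProb p (rotate c x) i = stayProb p x (i + c) := fun i => by
    simp only [stayProb, rotate_apply, nbr_rotate]
  have hflip : ∀ i, flipProb p (rotate c x) i = flipProb p x (i + c) := fun i => by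
    simp only [flipProb, rotate_apply, nbr_rotate]
  simp only [submatrix_apply, transition, hstay, hflip, flipAt_rotate,
    EmbeddingLike.apply_eq_iff_eq]
  refine if_congr Iff.rfl (congrArg _ ?_) ?_
  · exact Equiv.sum_comp (Equiv.addRight c) fun i => stayProb p x i
  · exact Equiv.sum_comp (Equiv.addRight c) fun i =>
      if y = flipAt x i then (N : ℝ)⁻¹ * flipProb p x i else 0

section Marginals

variable (π : Config N → ℝ)

theorem sum_mul_apply_eq_sum_marginal₁ (g : Fin 2 → ℝ) (i : ZMod N) :
    ∑ x, π x * g (x i) = ∑ u, marginal₁ π i u * g u := by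
  rw [← Finset.sum_fiberwise _ fun x : Config N => x i]
  refine Finset.sum_congr rfl fun u _ => ?_
  rw [marginal₁, Finset.sum_mul]
  exact Finset.sum_congr rfl fun x hx => by rw [(Finset.mem_filter.1 hx).2]

theorem sum_mul_nbr_eq_sum_marginal₂ (g : Fin 4 → ℝ) (i : ZMod N) :
    ∑ x, π x * g (nbr x i) = ∑ u, ∑ v, marginal₂ π (i - 1) (i + 1) u v * g (code u v) := by
  rw [← Finset.sum_fiberwise _ fun x : Config N => (x (i - 1), x (i + 1)),
    Fintype.sum_prod_type]
  refine Finset.sum_congr rfl fun u _ => Finset.sum_congr rfl fun v _ => ?_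
  rw [marginal₂, Finset.sum_mul]
  simp only [Prod.mk.injEq]
  refine Finset.sum_congr rfl fun x hx => ?_
  obtain ⟨hu, hv⟩ := (Finset.mem_filter.1 hx).2
  rw [nbr, hu, hv]

end Marginals

/-- The mean profit per turn `μ^N` of the ensemble when the configuration is distributed according
to `π` and the next player is chosen uniformly at random. -/
noncomputable def meanProfit (p : Fin 4 → ℝ) (π : Config N → ℝ) : ℝ :=
  (N : ℝ)⁻¹ * ∑ x, π x * ∑ i, (p (nbr x i) - (1 - p (nbr x i)))

variable {p : Fin 4 → ℝ} {π : Config N → ℝ}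

theorem IsStationary.sum_mul_nbr_eq_marginal₁ (hπ : IsStationary (transition p) π) (i : ZMod N) :
    ∑ x, π x * p (nbr x i) = marginal₁ π i 1 := by
  let f : Config N → ℝ := fun x => if x i = 1 then 1 else 0
  have hmarginal : π ⬝ᵥ f = marginal₁ π i 1 :=
    (sum_mul_apply_eq_sum_marginal₁ π (fun u => if u = 1 then 1 else 0) i).trans (by simp)
  have hother : ∀ x j, j ≠ i → flipProb p x j * (f (flipAt x j) - f x) = 0 := fun x j hj => by
    simp only [f, flipAt, Function.update_of_ne hj.symm, sub_self, mul_zero]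
  have hself : ∀ x, flipProb p x i * (f (flipAt x i) - f x) = p (nbr x i) - f x := fun x => by
    rcases Fin.exists_fin_two.1 ⟨x i, rfl⟩ with hx | hx <;> simp [f, flipAt, flipProb, hx]
  have hstep : transition p *ᵥ f = f + (N : ℝ)⁻¹ • ((fun x => p (nbr x i)) - f) := by
    funext x
    rw [transition_mulVec_apply, Fintype.sum_eq_single i (hother x), hself]
    rfl
  have hbalance := hπ.dotProduct_mulVec f
  rw [hstep, dotProduct_add, add_eq_left, dotProduct_smul, smul_eq_zero_iff_right (NeZero.ne _),
    dotProduct_sub, sub_eq_zero, hmarginal] at hbalance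
  exact hbalance

namespace IsUniqueStationary

theorem marginal₁_eq (hπ : IsUniqueStationary (transition p) π) (i j : ZMod N) (u : Fin 2) :
    marginal₁ π i u = marginal₁ π j u :=
  Finset.sum_equiv (rotate (i - j))
    (fun x => by simp only [Finset.mem_filter_univ, rotate_apply, add_sub_cancel])
    fun x _ => (hπ.apply_equiv (transition_submatrix_rotate p _) x).symm

theorem marginal₂_eq (hπ : IsUniqueStationary (transition p) π) (i j k : ZMod N) (u v : Fin 2) :
    marginal₂ π i (i + k) u v = marginal₂ π j (j + k) u v :=
  Finset.sum_equiv (rotate (i - j))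
    (fun x => by
      simp only [Finset.mem_filter_univ, rotate_apply, add_sub_cancel, add_right_comm j k])
    fun x _ => (hπ.apply_equiv (transition_submatrix_rotate p _) x).symm

theorem sum_mul_nbr (hπ : IsUniqueStationary (transition p) π)
    (g : Fin 4 → ℝ) (i j : ZMod N) :
    ∑ x, π x * g (nbr x i) = ∑ u, ∑ v, marginal₂ π j (j + 2) u v * g (code u v) := by
  have hright : i + 1 = i - 1 + 2 := by ring
  simp only [sum_mul_nbr_eq_sum_marginal₂, hright, hπ.marginal₂_eq (i - 1) j]

theorem meanProfit_eq_sum_marginal₂ (hπ : IsUniqueStationary (transition p) π) (j : ZMod N) :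
    meanProfit p π =
      ∑ u, ∑ v, marginal₂ π j (j + 2) u v * (p (code u v) - (1 - p (code u v))) := by
  have hswap : ∑ x, π x * ∑ i, (p (nbr x i) - (1 - p (nbr x i))) =
      ∑ i, ∑ x, π x * (p (nbr x i) - (1 - p (nbr x i))) := by
    simp only [Finset.mul_sum]
    exact Finset.sum_comm
  rw [meanProfit, hswap]
  simp only [hπ.sum_mul_nbr (fun m => p m - (1 - p m)) _ j, Finset.sum_const,
    Finset.card_univ, ZMod.card, nsmul_eq_mul]
  exact inv_mul_cancel_left₀ (NeZero.ne _) _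

theorem meanProfit_eq_two_mul_sum_marginal₂_sub_one (hπ : IsUniqueStationary (transition p) π)
    (j : ZMod N) :
    meanProfit p π = 2 * (∑ u, ∑ v, marginal₂ π j (j + 2) u v * p (code u v)) - 1 := by
  have hmass : ∑ u, ∑ v, marginal₂ π j (j + 2) u v = 1 := by
    simpa [hπ.sum_eq_one] using (hπ.sum_mul_nbr 1 0 j).symm
  calc meanProfit p π
      = ∑ u, ∑ v, (2 * (marginal₂ π j (j + 2) u v * p (code u v)) - marginal₂ π j (j + 2) u v) := by
        rw [hπ.meanProfit_eq_sum_marginal₂ j]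
        refine Finset.sum_congr rfl fun u _ => Finset.sum_congr rfl fun v _ => ?_
        ring
    _ = 2 * (∑ u, ∑ v, marginal₂ π j (j + 2) u v * p (code u v)) - 1 := by
        simp only [Finset.sum_sub_distrib, ← Finset.mul_sum, hmass]

theorem meanProfit_eq_two_mul_marginal₁_sub_one (hπ : IsUniqueStationary (transition p) π)
    (i : ZMod N) : meanProfit p π = 2 * marginal₁ π i 1 - 1 := by
  rw [hπ.meanProfit_eq_two_mul_sum_marginal₂_sub_one 0, ← hπ.sum_mul_nbr p i,
    hπ.stationary.sum_mul_nbr_eq_marginal₁]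

theorem meanProfit_eq_marginal₁_sub_marginal₁ (hπ : IsUniqueStationary (transition p) π)
    (i : ZMod N) : meanProfit p π = marginal₁ π i 1 - marginal₁ π i 0 := by
  have hmass : marginal₁ π i 0 + marginal₁ π i 1 = 1 := by
    simpa [hπ.sum_eq_one] using (sum_mul_apply_eq_sum_marginal₁ π 1 i).symm
  linarith [hπ.meanProfit_eq_two_mul_marginal₁_sub_one i]

end IsUniqueStationary

theorem isUniqueStationary_augTransition (hπ : IsUniqueStationary (transition p) π) :
    IsUniqueStationary (augTransition p) fun s => (N : ℝ)⁻¹ * π s.1 := by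
  simpa only [ZMod.card] using
    hπ.prod_uniform (fun _ _ _ _ => rfl) (sum_augTransition_eq_transition p)

theorem IsMarkovChain.ae_tendsto_profit {Ω : Type*} [MeasurableSpace Ω] {ℙ : Measure Ω}
    [IsFiniteMeasure ℙ] {Z : ℕ → Ω → AugState N} (hZ : IsMarkovChain (augTransition p) ℙ Z)
    (hp : ∀ m, p m ∈ Set.Icc 0 1) (hπ : IsUniqueStationary (transition p) π) :
    ∀ᵐ ω ∂ℙ, Tendsto (fun n : ℕ => (n : ℝ)⁻¹ * profit Z n ω) atTop (𝓝 (meanProfit p π)) := by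
  have hmean : ∑ s : AugState N, (N : ℝ)⁻¹ * π s.1 *
      ∑ t, augTransition p s t * payoff s t = meanProfit p π := by
    simp only [sum_augTransition_mul_payoff]
    simp only [Fintype.sum_prod_type, meanProfit, mul_assoc, Finset.mul_sum]
  rw [← hmean]
  exact hZ.ae_tendsto_average (augTransition_mem_rowStochastic hp)
    (isUniqueStationary_augTransition hπ) payoff

end Game

theorem mainTheorem5_general (N : ℕ) [NeZero N] (p : Fin 4 → ℝ)
    (hp : ∀ m, p m ∈ Set.Icc (0 : ℝ) 1) (π : Config N → ℝ)
    (hπ : IsUniqueStationary (transition p) π) :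
    ∃ μN : ℝ,
      (∀ (Ω : Type*) [MeasurableSpace Ω] (ℙ : Measure Ω) [IsProbabilityMeasure ℙ]
        (Z : ℕ → Ω → AugState N), IsMarkovChain (augTransition p) ℙ Z →
          ∀ᵐ ω ∂ℙ, Tendsto (fun n : ℕ => (n : ℝ)⁻¹ * profit Z n ω) atTop (𝓝 μN)) ∧
      μN = (N : ℝ)⁻¹ * ∑ x : Config N, π x *
        ∑ i : ZMod N, (p (nbr x i) - (1 - p (nbr x i))) ∧
      (∀ (i : ZMod N) (u v : Fin 2), marginal₂ π i (i + 2) u v = marginal₂ π 1 3 u v) ∧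
      μN = ∑ u : Fin 2, ∑ v : Fin 2, marginal₂ π 1 3 u v * (p (code u v) - (1 - p (code u v))) ∧
      μN = 2 * (marginal₂ π 1 3 0 0 * p 0 + marginal₂ π 1 3 0 1 * p 1 +
        marginal₂ π 1 3 1 0 * p 2 + marginal₂ π 1 3 1 1 * p 3) - 1 ∧
      (∀ (i : ZMod N) (u : Fin 2), marginal₁ π i u = marginal₁ π 1 u) ∧
      μN = marginal₁ π 1 1 - marginal₁ π 1 0 ∧
      μN = 2 * marginal₁ π 1 1 - 1 := by
  rw [show (3 : ZMod N) = 1 + 2 by norm_num]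
  refine ⟨meanProfit p π, fun Ω _ ℙ _ Z hZ => hZ.ae_tendsto_profit hp hπ, rfl,
    fun i u v => hπ.marginal₂_eq i 1 2 u v, hπ.meanProfit_eq_sum_marginal₂ 1, ?_,
    fun i u => hπ.marginal₁_eq i 1 u, hπ.meanProfit_eq_marginal₁_sub_marginal₁ 1,
    hπ.meanProfit_eq_two_mul_marginal₁_sub_one 1⟩
  rw [hπ.meanProfit_eq_two_mul_sum_marginal₂_sub_one 1, Fin.sum_univ_two, Fin.sum_univ_two,
    Fin.sum_univ_two, ← add_assoc]
  rfl

end Parrondo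

open Parrondo in
theorem mainTheorem5 (N : ℕ) [NeZero N] (hN : 3 ≤ N) (p : Fin 4 → ℝ)
    (hp : ∀ m, p m ∈ Set.Icc (0 : ℝ) 1) (π : Config N → ℝ)
    (herg : IsErgodicWith (transition p) π) :
    ∃ μN : ℝ,
      -- strong law of large numbers, for every initial distribution
      (∀ (Ω : Type*) [MeasurableSpace Ω] (ℙ : Measure Ω) [IsProbabilityMeasure ℙ]
        (Z : ℕ → Ω → AugState N), IsMarkovChain (augTransition p) ℙ Z →
          ∀ᵐ ω ∂ℙ, Tendsto (fun n : ℕ => (n : ℝ)⁻¹ * profit Z n ω) atTop (𝓝 μN)) ∧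
      -- in terms of the stationary distribution
      μN = (N : ℝ)⁻¹ * ∑ x : Config N, π x *
        ∑ i : ZMod N, (p (nbr x i) - (1 - p (nbr x i))) ∧
      -- in terms of the two-dimensional marginals
      (∀ (i : ZMod N) (u v : Fin 2), marginal₂ π i (i + 2) u v = marginal₂ π 1 3 u v) ∧
      μN = ∑ u : Fin 2, ∑ v : Fin 2, marginal₂ π 1 3 u v * (p (code u v) - (1 - p (code u v))) ∧
      μN = 2 * (marginal₂ π 1 3 0 0 * p 0 + marginal₂ π 1 3 0 1 * p 1 +
        marginal₂ π 1 3 1 0 * p 2 + marginal₂ π 1 3 1 1 * p 3) - 1 ∧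
      -- in terms of the one-dimensional marginals
      (∀ (i : ZMod N) (u : Fin 2), marginal₁ π i u = marginal₁ π 1 u) ∧
      μN = marginal₁ π 1 1 - marginal₁ π 1 0 ∧
      μN = 2 * marginal₁ π 1 1 - 1 :=
  mainTheorem5_general N p hp π herg.isUniqueStationary
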